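/- Let $G=(V,E)$ be a finite simple graph, and let $Z_G=\sum_{\{u,v\}\in E}[e_u,e_v]\subset\mathbb{R}^V$ be its graphical zonotope, that is, the Minkowski sum over all edges $\{u,v\}$ of $G$ of the segments between the standard basis vectors $e_u$ and $e_v$. The deformation cone $\mathbb{DC}(Z_G)$ is the set of all weak Minkowski summands of $Z_G$, i.e. of all nonempty polytopes $Q\subset\mathbb{R}^V$ for which there are a polytope $R$ and a scalar $\lambda\ge 0$ with $Q+R=\lambda Z_G$; it is regarded as a convex cone in the real vector space of virtual polytopes (formal differences of nonempty polytopes of $\mathbb{R}^V$, i.e. the Grothendieck group of the monoid of polytopes under Minkowski addition, with the scalar multiplication that extends dilation by nonnegative scalars). The lineality space of a convex cone $C$ is $C\cap(-C)$. A cone is simplicial if it is the set of nonnegative linear combinations of a finite linearly independent set of vectors. Then $\mathbb{DC}(Z_G)$ is simplicial modulo its lineality, that is, its image in the quotient of the space of virtual polytopes by the lineality space of $\mathbb{DC}(Z_G)$ is a simplicial cone, if and only if $G$ is triangle-free (has no three pairwise adjacent vertices). -/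

import Mathlib

open scoped NNReal Pointwise

noncomputable section

/-! ### Polytopes and virtual polytopes -/

section Polytopes

variable (E : Type*) [AddCommGroup E] [Module ℝ E] [TopologicalSpace E]
  [IsTopologicalAddGroup E] [ContinuousSMul ℝ E]

/-- The (nonempty) polytopes of `E`, that is, the convex hulls of finitely many points. Addition is
the Minkowski sum and scalar multiplication is dilation by nonnegative scalars. -/
def polytopes : Submodule ℝ≥0 (ConvexBody E) where
  carrier := {K | ∃ s : Set E, s.Finite ∧ (K : Set E) = convexHull ℝ s}
  zero_mem' := ⟨{0}, Set.finite_singleton 0, by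
    rw [convexHull_singleton, ConvexBody.coe_zero, Set.singleton_zero]⟩
  add_mem' := by
    rintro K L ⟨s, hs, hK⟩ ⟨t, ht, hL⟩
    exact ⟨s + t, hs.add ht, by rw [ConvexBody.coe_add, hK, hL, convexHull_add]⟩
  smul_mem' := by
    rintro c K ⟨s, hs, hK⟩
    exact ⟨(c : ℝ) • s, hs.smul_set, by
      rw [ConvexBody.coe_smul', hK, convexHull_smul]; rfl⟩

/-- The type of (nonempty) polytopes of `E`. -/
abbrev Polytope : Type _ := polytopes E

/-- Virtual polytopes: formal differences `P - Q` of polytopes, that is, the Grothendieck group of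
the commutative monoid of polytopes under Minkowski sum. -/
def VirtualPolytope : Type _ := Algebra.GrothendieckAddGroup (Polytope E)

namespace VirtualPolytope

instance : AddCommGroup (VirtualPolytope E) :=
  inferInstanceAs (AddCommGroup (Algebra.GrothendieckAddGroup (Polytope E)))

variable {E}

/-- The virtual polytope `P - {0}` of a polytope `P`. -/
def of : Polytope E →+ VirtualPolytope E :=
  Algebra.GrothendieckAddGroup.of (M := Polytope E)

/-- Additive maps on virtual polytopes are determined by their values on polytopes. -/
theorem addHom_ext {f g : VirtualPolytope E →+ VirtualPolytope E}
    (h : ∀ P, f (of P) = g (of P)) : f = g :=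
  (Algebra.GrothendieckAddGroup.lift (M := Polytope E) (G := VirtualPolytope E)).symm.injective
    (AddMonoidHom.ext h)

/-- The dilation `P - Q ↦ c • P - c • Q` of virtual polytopes by a nonnegative scalar `c`. -/
def dilate (c : ℝ≥0) : VirtualPolytope E →+ VirtualPolytope E :=
  Algebra.GrothendieckAddGroup.lift (M := Polytope E) (G := VirtualPolytope E)
    (of.comp (DistribSMul.toAddMonoidHom (Polytope E) c))

theorem dilate_of (c : ℝ≥0) (P : Polytope E) : dilate c (of P) = of (c • P) :=
  DFunLike.congr_fun ((Algebra.GrothendieckAddGroup.lift (M := Polytope E)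
    (G := VirtualPolytope E)).symm_apply_apply
      (of.comp (DistribSMul.toAddMonoidHom (Polytope E) c))) P

theorem dilate_one : dilate (E := E) 1 = AddMonoidHom.id _ :=
  addHom_ext fun P => by rw [dilate_of, one_smul, AddMonoidHom.id_apply]

theorem dilate_zero : dilate (E := E) 0 = 0 :=
  addHom_ext fun P => by rw [dilate_of, zero_smul, map_zero, AddMonoidHom.zero_apply]

theorem dilate_add (a b : ℝ≥0) : dilate (E := E) (a + b) = dilate a + dilate b :=
  addHom_ext fun P => by
    rw [AddMonoidHom.add_apply, dilate_of, dilate_of, dilate_of, add_smul, map_add]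

theorem dilate_mul (a b : ℝ≥0) : dilate (E := E) (a * b) = (dilate a).comp (dilate b) :=
  addHom_ext fun P => by
    rw [AddMonoidHom.comp_apply, dilate_of, dilate_of, dilate_of, mul_smul]

/-- Scalar multiplication of virtual polytopes by real numbers: for `r ≥ 0`,
`r • (P - Q) = r • P - r • Q`, and for `r < 0`, `r • (P - Q) = (-r) • Q - (-r) • P`. -/
instance : SMul ℝ (VirtualPolytope E) where
  smul r x := if 0 ≤ r then dilate r.toNNReal x else -dilate (-r).toNNReal x

theorem smul_def (r : ℝ) (x : VirtualPolytope E) :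
    r • x = if 0 ≤ r then dilate r.toNNReal x else -dilate (-r).toNNReal x := rfl

theorem smul_of_sub (a b : ℝ≥0) (x : VirtualPolytope E) :
    ((a : ℝ) - b) • x = dilate a x - dilate b x := by
  rw [smul_def]
  split_ifs with h
  · rw [eq_sub_iff_add_eq, ← AddMonoidHom.add_apply, ← dilate_add]
    congr 2
    apply NNReal.coe_injective
    rw [NNReal.coe_add, Real.coe_toNNReal _ h]
    ring
  · rw [eq_sub_iff_add_eq, neg_add_eq_sub, sub_eq_iff_eq_add, ← AddMonoidHom.add_apply,
      ← dilate_add]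
    congr 2
    apply NNReal.coe_injective
    rw [NNReal.coe_add, Real.coe_toNNReal _ (by linarith)]
    ring

theorem exists_sub (r : ℝ) : ∃ a b : ℝ≥0, r = (a : ℝ) - b :=
  ⟨r.toNNReal, (-r).toNNReal, by
    rw [Real.coe_toNNReal', Real.coe_toNNReal']
    rcases le_total 0 r with h | h
    · rw [max_eq_left h, max_eq_right (by linarith)]; ring
    · rw [max_eq_right h, max_eq_left (by linarith)]; ring⟩

instance : Module ℝ (VirtualPolytope E) where
  one_smul x := by
    have h := smul_of_sub 1 0 x
    rw [dilate_one, dilate_zero] at h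
    simpa using h
  zero_smul x := by
    have h := smul_of_sub 0 0 x
    rw [dilate_zero] at h
    simpa using h
  smul_zero r := by
    obtain ⟨a, b, rfl⟩ := exists_sub r
    rw [smul_of_sub, map_zero, map_zero, sub_zero]
  smul_add r x y := by
    obtain ⟨a, b, rfl⟩ := exists_sub r
    simp only [smul_of_sub, map_add]
    abel
  add_smul r s x := by
    obtain ⟨a, b, rfl⟩ := exists_sub r
    obtain ⟨c, d, rfl⟩ := exists_sub s
    rw [show (a : ℝ) - b + (c - d) = ((a + c : ℝ≥0) : ℝ) - ((b + d : ℝ≥0) : ℝ) by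
      push_cast; ring]
    simp only [smul_of_sub, dilate_add, AddMonoidHom.add_apply]
    abel
  mul_smul r s x := by
    obtain ⟨a, b, rfl⟩ := exists_sub r
    obtain ⟨c, d, rfl⟩ := exists_sub s
    rw [show ((a : ℝ) - b) * (c - d)
        = ((a * c + b * d : ℝ≥0) : ℝ) - ((a * d + b * c : ℝ≥0) : ℝ) by push_cast; ring]
    simp only [smul_of_sub, dilate_add, dilate_mul, AddMonoidHom.add_apply,
      AddMonoidHom.comp_apply, map_sub]
    abel

theorem coe_smul_of (c : ℝ≥0) (P : Polytope E) : (c : ℝ) • of P = of (c • P) := by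
  have h := smul_of_sub c 0 (of P)
  rw [dilate_zero, dilate_of] at h
  simpa using h

end VirtualPolytope

variable {E}

/-! ### Deformation cones -/

/-- `Q` is a weak Minkowski summand (a deformation) of `P` if `Q + R = c • P` for some polytope `R`
and some scalar `c ≥ 0`. -/
def IsWeakMinkowskiSummand (Q P : Polytope E) : Prop :=
  ∃ (c : ℝ≥0) (R : Polytope E), Q + R = c • P

/-- The deformation cone of a polytope `P`: the set of all weak Minkowski summands of `P`, as a
convex cone in the real vector space of virtual polytopes. -/
def deformationCone (P : Polytope E) : PointedCone ℝ (VirtualPolytope E) where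
  carrier := {x | ∃ Q : Polytope E, IsWeakMinkowskiSummand Q P ∧ VirtualPolytope.of Q = x}
  zero_mem' := ⟨0, ⟨0, 0, by rw [add_zero, zero_smul]⟩, map_zero _⟩
  add_mem' := by
    rintro _ _ ⟨Q, ⟨c, R, h⟩, rfl⟩ ⟨Q', ⟨c', R', h'⟩, rfl⟩
    exact ⟨Q + Q', ⟨c + c', R + R', by rw [add_add_add_comm, h, h', add_smul]⟩, map_add _ _ _⟩
  smul_mem' := by
    rintro ⟨a, ha⟩ _ ⟨Q, ⟨c, R, h⟩, rfl⟩
    exact ⟨a.toNNReal • Q, ⟨a.toNNReal * c, a.toNNReal • R, by rw [← smul_add, h, mul_smul]⟩, by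
      rw [← VirtualPolytope.coe_smul_of, Real.coe_toNNReal a ha]; rfl⟩

/-- The line segment `[x, y]`, as a polytope. -/
def segmentPolytope (x y : E) : Polytope E :=
  ⟨⟨segment ℝ x y, convex_segment x y, by
      rw [← convexHull_pair]; exact (Set.toFinite {x, y}).isCompact_convexHull (𝕜 := ℝ),
      ⟨x, left_mem_segment ℝ x y⟩⟩,
    {x, y}, Set.toFinite _, (convexHull_pair x y).symm⟩

theorem segmentPolytope_comm (x y : E) : segmentPolytope x y = segmentPolytope y x :=
  Subtype.ext (ConvexBody.ext (segment_symm ℝ x y))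

end Polytopes

/-- A convex cone `C` is simplicial modulo its lineality space `C ∩ -C` if its image in the quotient
of the ambient space by the lineality space is a simplicial cone. -/
def PointedCone.IsSimplicialModLineality {M : Type*} [AddCommGroup M] [Module ℝ M]
    (C : PointedCone ℝ M) : Prop :=
  (C.map C.lineal.mkQ).IsSimplicial

/-- The graphical zonotope of `G`: the Minkowski sum in `ℝ^V` of the segments `[e_u, e_v]` over all
edges `uv` of `G`. -/
def graphicalZonotope {V : Type*} [Fintype V] [DecidableEq V] (G : SimpleGraph V)
    [DecidableRel G.Adj] : Polytope (V → ℝ) :=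
  ∑ e ∈ G.edgeFinset, Sym2.lift
    ⟨fun u v => segmentPolytope (Pi.single u (1 : ℝ)) (Pi.single v (1 : ℝ)),
      fun _ _ => segmentPolytope_comm _ _⟩ e

end

/-! Polytopes are replaced by their support functions. A weak Minkowski summand of `Z_G` has a
support function additive on each region of the graphical arrangement of `G`. Such a positively
homogeneous function is determined by its values on indicators of cliques
(`AdditiveOnRegions.eq_zero`).

If `G` is triangle-free, the only cliques are the empty set, vertices and edges. Vertex values are
matched by a translation and edge values by multiples of the edge segments, so every summand is a
translate of a nonnegative combination of these segments. The functionals `edgeDefect` are dual to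
the segments, which are therefore independent modulo lineality.

Conversely, on a triangle `ijk` the sum of the three edge segments is also a triangle plus its
inverted copy. A simplicial cone has the Riesz decomposition property, so modulo lineality the
triangle would split into three pieces, one below each segment. The functional `thirdDifference` is
1 on the triangle but at most 0 on each piece, because on the cone it is bounded by the defect at
`ij` and by the defect at `ik`, and a defect vanishes on the segments of the other edges. -/

section SupportFunction

/-! ### Support functions of polytopes and virtual polytopes -/

variable {V : Type*} [Fintype V]

/-- The support function `c ↦ max_{x ∈ P} ⟨c, x⟩` of a polytope. -/
noncomputable def Polytope.support (P : Polytope (V → ℝ)) (c : V → ℝ) : ℝ :=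
  sSup ((fun x => c ⬝ᵥ x) '' ((P : ConvexBody (V → ℝ)) : Set (V → ℝ)))

namespace Polytope

theorem isGreatest_support (P : Polytope (V → ℝ)) (c : V → ℝ) :
    IsGreatest ((fun x => c ⬝ᵥ x) '' ((P : ConvexBody (V → ℝ)) : Set (V → ℝ))) (P.support c) :=
  (P.1.isCompact.image (by unfold dotProduct; fun_prop)).isGreatest_sSup (P.1.nonempty.image _)

theorem dotProduct_le_support (P : Polytope (V → ℝ)) (c : V → ℝ) {x : V → ℝ}
    (hx : x ∈ (P : ConvexBody (V → ℝ))) : c ⬝ᵥ x ≤ P.support c :=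
  (P.isGreatest_support c).2 ⟨x, hx, rfl⟩

theorem exists_dotProduct_eq_support (P : Polytope (V → ℝ)) (c : V → ℝ) :
    ∃ x ∈ (P : ConvexBody (V → ℝ)), c ⬝ᵥ x = P.support c :=
  (P.isGreatest_support c).1

theorem support_eq_of_convexHull {P : Polytope (V → ℝ)} {s : Set (V → ℝ)}
    (h : ((P : ConvexBody (V → ℝ)) : Set (V → ℝ)) = convexHull ℝ s) {c : V → ℝ} {m : ℝ}
    (hm : IsGreatest ((fun x => c ⬝ᵥ x) '' s) m) : P.support c = m := by
  refine (P.isGreatest_support c).unique ⟨?_, ?_⟩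
  · rw [h]
    exact Set.image_mono (subset_convexHull ℝ s) hm.1
  · rintro _ ⟨x, hx, rfl⟩
    rw [h] at hx
    have hs : s ⊆ {x | c ⬝ᵥ x ≤ m} := fun y hy => hm.2 ⟨y, hy, rfl⟩
    have hlin : IsLinearMap ℝ (fun x : V → ℝ => c ⬝ᵥ x) :=
      ⟨fun x y => dotProduct_add c x y, fun r x => dotProduct_smul r c x⟩
    exact convexHull_min hs (convex_halfSpace_le hlin m) hx

theorem support_add (P Q : Polytope (V → ℝ)) (c : V → ℝ) :
    (P + Q).support c = P.support c + Q.support c := by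
  refine ((P + Q).isGreatest_support c).unique ⟨?_, ?_⟩
  · obtain ⟨x, hx, hxc⟩ := P.exists_dotProduct_eq_support c
    obtain ⟨y, hy, hyc⟩ := Q.exists_dotProduct_eq_support c
    exact ⟨x + y, Set.add_mem_add hx hy, by simp only [dotProduct_add, hxc, hyc]⟩
  · rintro _ ⟨_, ⟨x, hx, y, hy, rfl⟩, rfl⟩
    simp only [dotProduct_add]
    exact add_le_add (P.dotProduct_le_support c hx) (Q.dotProduct_le_support c hy)

theorem support_smul (r : ℝ≥0) (P : Polytope (V → ℝ)) (c : V → ℝ) :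
    (r • P).support c = r * P.support c := by
  refine ((r • P).isGreatest_support c).unique ⟨?_, ?_⟩
  · obtain ⟨x, hx, hxc⟩ := P.exists_dotProduct_eq_support c
    exact ⟨r • x, Set.smul_mem_smul_set hx, by simp only [← hxc]; exact dotProduct_smul (r : ℝ) c x⟩
  · rintro _ ⟨_, ⟨x, hx, rfl⟩, rfl⟩
    have : c ⬝ᵥ ((r : ℝ) • x) = r * (c ⬝ᵥ x) := dotProduct_smul (r : ℝ) c x
    exact this.trans_le (mul_le_mul_of_nonneg_left (P.dotProduct_le_support c hx) r.2)

/-- The support function, as an additive map on polytopes. -/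
noncomputable def supportHom : Polytope (V → ℝ) →+ ((V → ℝ) → ℝ) where
  toFun := support
  map_zero' := by
    funext c
    have h := support_smul (0 : ℝ≥0) (0 : Polytope (V → ℝ)) c
    rwa [smul_zero, NNReal.coe_zero, zero_mul] at h
  map_add' P Q := funext fun c => support_add P Q c

theorem support_zero (c : V → ℝ) : (0 : Polytope (V → ℝ)).support c = 0 :=
  congr_fun (map_zero supportHom) c

theorem support_sum {ι : Type*} (s : Finset ι) (P : ι → Polytope (V → ℝ)) (c : V → ℝ) :
    (∑ i ∈ s, P i).support c = ∑ i ∈ s, (P i).support c := by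
  have h := congr_fun (map_sum supportHom P s) c
  rwa [Finset.sum_apply] at h

theorem support_add_le (P : Polytope (V → ℝ)) (c d : V → ℝ) :
    P.support (c + d) ≤ P.support c + P.support d := by
  obtain ⟨x, hx, hxc⟩ := P.exists_dotProduct_eq_support (c + d)
  rw [← hxc, add_dotProduct]
  exact add_le_add (P.dotProduct_le_support c hx) (P.dotProduct_le_support d hx)

theorem support_smul_right (P : Polytope (V → ℝ)) {r : ℝ} (hr : 0 ≤ r) (c : V → ℝ) :
    P.support (r • c) = r * P.support c := by
  refine (P.isGreatest_support (r • c)).unique ⟨?_, ?_⟩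
  · obtain ⟨x, hx, hxc⟩ := P.exists_dotProduct_eq_support c
    exact ⟨x, hx, by simp only [smul_dotProduct, hxc, smul_eq_mul]⟩
  · rintro _ ⟨x, hx, rfl⟩
    simp only [smul_dotProduct, smul_eq_mul]
    exact mul_le_mul_of_nonneg_left (P.dotProduct_le_support c hx) hr

/-- A point of `P` outside `Q` would be strictly separated from `Q` by a linear functional, which is
a dot product. -/
theorem le_of_support_le {P Q : Polytope (V → ℝ)} (h : ∀ c, P.support c ≤ Q.support c) :
    (P : ConvexBody (V → ℝ)) ≤ Q := by
  classical
  intro x hx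
  by_contra hxQ
  obtain ⟨f, u, hf, hu⟩ := geometric_hahn_banach_closed_point Q.1.convex Q.1.isClosed hxQ
  have hdot : ∀ y : V → ℝ, (fun v => f (Pi.single v 1)) ⬝ᵥ y = f y := by
    intro y
    conv_rhs => rw [pi_eq_sum_univ' y, map_sum]
    refine Finset.sum_congr rfl fun v _ => ?_
    rw [map_smul, smul_eq_mul, mul_comm]
  obtain ⟨y, hy, hyc⟩ := Q.exists_dotProduct_eq_support (fun v => f (Pi.single v 1))
  have h1 := P.dotProduct_le_support (fun v => f (Pi.single v 1)) hx
  have h2 := h (fun v => f (Pi.single v 1))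
  rw [← hyc, hdot] at h2
  rw [hdot] at h1
  linarith [hf y hy]

theorem ext_support {P Q : Polytope (V → ℝ)} (h : ∀ c, P.support c = Q.support c) : P = Q :=
  Subtype.ext (le_antisymm (le_of_support_le fun c => (h c).le)
    (le_of_support_le fun c => (h c).ge))

/-- The convex hull of a finite nonempty set, as a polytope. -/
def ofFinite (s : Set (V → ℝ)) (hs : s.Finite) (hne : s.Nonempty) : Polytope (V → ℝ) :=
  ⟨⟨convexHull ℝ s, convex_convexHull ℝ s, hs.isCompact_convexHull (𝕜 := ℝ),
    hne.convexHull⟩, s, hs, rfl⟩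

theorem support_segmentPolytope (x y c : V → ℝ) :
    (segmentPolytope x y).support c = max (c ⬝ᵥ x) (c ⬝ᵥ y) := by
  refine support_eq_of_convexHull (convexHull_pair x y).symm ?_
  rw [Set.image_pair]
  exact isGreatest_pair

theorem support_ofFinite_triple (x y z c : V → ℝ) :
    (ofFinite {x, y, z} (Set.toFinite _) (Set.insert_nonempty _ _)).support c =
      max (c ⬝ᵥ x) (max (c ⬝ᵥ y) (c ⬝ᵥ z)) := by
  refine support_eq_of_convexHull rfl ?_
  rw [Set.image_insert_eq, Set.image_pair]
  exact isGreatest_pair.insert _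

end Polytope

namespace VirtualPolytope

theorem exists_of_sub_of {E : Type*} [AddCommGroup E] [Module ℝ E] [TopologicalSpace E]
    [IsTopologicalAddGroup E] [ContinuousSMul ℝ E] (x : VirtualPolytope E) :
    ∃ P Q : Polytope E, x = of P - of Q := by
  induction x using AddLocalization.ind with
  | H y =>
    refine ⟨y.1, y.2, eq_sub_iff_add_eq.2 ?_⟩
    change (AddLocalization.mk y.1 y.2 : Algebra.GrothendieckAddGroup (Polytope E)) +
      Algebra.GrothendieckAddGroup.of (y.2 : Polytope E) = Algebra.GrothendieckAddGroup.of y.1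
    rw [Algebra.GrothendieckAddGroup.of]
    change _ + AddLocalization.addMonoidOf _ _ = AddLocalization.addMonoidOf _ _
    rw [← AddLocalization.mk_zero_eq_addMonoidOf_mk, ← AddLocalization.mk_zero_eq_addMonoidOf_mk,
      AddLocalization.mk_add, AddLocalization.mk_eq_mk_iff, AddLocalization.r_iff_exists]
    exact ⟨0, by simp [add_comm]⟩

/-- The support function, as a linear map on virtual polytopes. -/
noncomputable def support : VirtualPolytope (V → ℝ) →ₗ[ℝ] ((V → ℝ) → ℝ) :=
  let f : VirtualPolytope (V → ℝ) →+ ((V → ℝ) → ℝ) :=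
    Algebra.GrothendieckAddGroup.lift (M := Polytope (V → ℝ)) Polytope.supportHom
  have hf (P : Polytope (V → ℝ)) : f (of P) = P.support :=
    DFunLike.congr_fun ((Algebra.GrothendieckAddGroup.lift (M := Polytope (V → ℝ))
      ).symm_apply_apply Polytope.supportHom) P
  { f with
    map_smul' := by
      intro r x
      obtain ⟨P, Q, rfl⟩ := exists_of_sub_of x
      obtain ⟨a, b, rfl⟩ := exists_sub r
      funext c
      change f _ c = ((a : ℝ) - b) • f _ c
      simp only [smul_of_sub, map_sub, dilate_of, hf, Pi.sub_apply, Polytope.support_smul,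
        smul_eq_mul]
      ring }

theorem support_of (P : Polytope (V → ℝ)) : support (of P) = P.support :=
  DFunLike.congr_fun ((Algebra.GrothendieckAddGroup.lift (M := Polytope (V → ℝ))
    ).symm_apply_apply Polytope.supportHom) P

/-- The defect of additivity `h(c) + h(d) - h(c + d)` of the support function `h`. -/
noncomputable def defect (c d : V → ℝ) : VirtualPolytope (V → ℝ) →ₗ[ℝ] ℝ :=
  (LinearMap.proj (R := ℝ) (φ := fun _ => ℝ) c + LinearMap.proj (R := ℝ) (φ := fun _ => ℝ) d -
    LinearMap.proj (R := ℝ) (φ := fun _ => ℝ) (c + d)) ∘ₗ support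

theorem defect_of (c d : V → ℝ) (P : Polytope (V → ℝ)) :
    defect c d (of P) = P.support c + P.support d - P.support (c + d) := by
  simp [defect, support_of]

theorem defect_comm (c d : V → ℝ) : defect c d = defect d c := by
  rw [defect, defect, add_comm c d, add_comm (LinearMap.proj c)]

theorem defect_of_nonneg (c d : V → ℝ) (P : Polytope (V → ℝ)) : 0 ≤ defect c d (of P) := by
  rw [defect_of]
  linarith [P.support_add_le c d]

/-- Points are invertible under Minkowski sum, so with the scalar 0 they are weak summands of every
polytope: translations are invisible modulo lineality. -/
theorem of_point_mem_lineal (t : V → ℝ) (P : Polytope (V → ℝ)) :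
    of (segmentPolytope t t) ∈ (deformationCone P).lineal := by
  have h (t : V → ℝ) : segmentPolytope t t + segmentPolytope (-t) (-t) = 0 :=
    Polytope.ext_support fun c => by
      simp [Polytope.support_add, Polytope.support_segmentPolytope, Polytope.support_zero]
  refine ⟨⟨_, ⟨0, _, (h t).trans (zero_smul _ _).symm⟩, rfl⟩,
    ⟨_, ⟨0, _, (h (-t)).trans (zero_smul _ _).symm⟩, ?_⟩⟩
  rw [eq_neg_iff_add_eq_zero, add_comm, ← map_add, h, map_zero]

end VirtualPolytope

/-- The subadditivity inequalities of `Q` and `R` add up to an equality, so each of them is an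
equality. -/
theorem IsWeakMinkowskiSummand.support_add {P Q : Polytope (V → ℝ)}
    (h : IsWeakMinkowskiSummand Q P) {c d : V → ℝ}
    (hP : P.support (c + d) = P.support c + P.support d) :
    Q.support (c + d) = Q.support c + Q.support d := by
  obtain ⟨r, R, h⟩ := h
  have key (c) : Q.support c + R.support c = r * P.support c := by
    rw [← Polytope.support_add, h, Polytope.support_smul]
  have h1 := key (c + d)
  rw [hP, mul_add, ← key c, ← key d] at h1
  linarith [Q.support_add_le c d, R.support_add_le c d]

end SupportFunction

/-! ### Functions additive on the regions of the graphical arrangement -/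

namespace SimpleGraph

variable {V : Type*}

/-- A function `F` is additive on pairs of vectors that order the ends of every edge of `G` in the
same way. -/
def AdditiveOnRegions (G : SimpleGraph V) (F : (V → ℝ) → ℝ) : Prop :=
  ∀ c d : V → ℝ, (∀ u v, G.Adj u v → (c u ≤ c v ∧ d u ≤ d v) ∨ (c v ≤ c u ∧ d v ≤ d u)) →
    F (c + d) = F c + F d

namespace AdditiveOnRegions

variable {G : SimpleGraph V} {F : (V → ℝ) → ℝ}

theorem sub {F' : (V → ℝ) → ℝ} (hF : G.AdditiveOnRegions F) (hF' : G.AdditiveOnRegions F') :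
    G.AdditiveOnRegions (F - F') := fun c d h => by
  simp only [Pi.sub_apply, hF c d h, hF' c d h]
  ring

theorem smul (r : ℝ) (hF : G.AdditiveOnRegions F) : G.AdditiveOnRegions (r • F) :=
  fun c d h => by simp only [Pi.smul_apply, hF c d h, smul_add]

theorem sum {ι : Type*} {s : Finset ι} {f : ι → (V → ℝ) → ℝ}
    (h : ∀ i ∈ s, G.AdditiveOnRegions (f i)) : G.AdditiveOnRegions (∑ i ∈ s, f i) := by
  intro c d hcd
  simp only [Finset.sum_apply, ← Finset.sum_add_distrib]
  exact Finset.sum_congr rfl fun i hi => h i hi c d hcd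

theorem linearMap (f : (V → ℝ) →ₗ[ℝ] ℝ) : G.AdditiveOnRegions f := fun c d _ => map_add f c d

/-- For nonadjacent `u, v` in `s`, the indicators of `s \ u` and `s \ v` have the same sum as those
of `s` and `s \ {u, v}`. Additivity on both sides expresses the value at `s` through smaller sets.
-/
theorem indicator_eq_zero (hF : G.AdditiveOnRegions F)
    (hclique : ∀ s : Finset V, G.IsClique s → F ((s : Set V).indicator 1) = 0) (s : Finset V) :
    F ((s : Set V).indicator 1) = 0 := by
  classical
  induction s using Finset.strongInduction with
  | H s ih =>
    by_cases hs : G.IsClique s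
    · exact hclique s hs
    · simp only [isClique_iff, Set.Pairwise, not_forall] at hs
      obtain ⟨u, hu, v, hv, huv, hadj⟩ := hs
      simp only [Finset.mem_coe] at hu hv
      have h1 := ih _ (Finset.erase_ssubset hu)
      have h2 := ih _ (Finset.erase_ssubset hv)
      have h3 := ih ((s.erase u).erase v)
        ((Finset.erase_subset _ _).trans_ssubset (Finset.erase_ssubset hu))
      -- The two indicators order only the pair `u, v` in opposite ways, and this pair is not an
      -- edge.
      have h4 := hF ((s.erase u : Set V).indicator 1) ((s.erase v : Set V).indicator 1) (by
        intro x y hxy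
        have hne : ¬ (x = u ∧ y = v) := by rintro ⟨rfl, rfl⟩; exact hadj hxy
        have hne' : ¬ (x = v ∧ y = u) := by rintro ⟨rfl, rfl⟩; exact hadj hxy.symm
        simp only [Set.indicator_apply, Finset.mem_coe, Finset.mem_erase, Pi.one_apply]
        have := hxy.ne
        by_cases x = u <;> by_cases x = v <;> by_cases y = u <;> by_cases y = v <;>
          by_cases x ∈ s <;> by_cases y ∈ s <;> simp_all)
      have h5 := hF ((s : Set V).indicator 1) (((s.erase u).erase v : Set V).indicator 1) (by
        intro x y hxy
        simp only [Set.indicator_apply, Finset.mem_coe, Finset.mem_erase, Pi.one_apply]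
        by_cases x = u <;> by_cases x = v <;> by_cases y = u <;> by_cases y = v <;>
          by_cases x ∈ s <;> by_cases y ∈ s <;> simp_all)
      have h6 : ((s.erase u : Set V).indicator 1 : V → ℝ) + (s.erase v : Set V).indicator 1 =
          (s : Set V).indicator 1 + ((s.erase u).erase v : Set V).indicator 1 := by
        funext x
        simp only [Set.indicator_apply, Finset.mem_coe, Finset.mem_erase, Pi.one_apply,
          Pi.add_apply]
        by_cases x = u <;> by_cases x = v <;> by_cases x ∈ s <;> simp_all
      rw [h6, h5, h1, h2, h3] at h4
      linarith

/-- Layer-cake decomposition: a nonnegative vector is a nonnegative combination of indicators of a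
chain of sets, all lying in a common region. -/
theorem eq_zero_of_nonneg [Fintype V] (hF : G.AdditiveOnRegions F)
    (hsmul : ∀ (r : ℝ) c, 0 ≤ r → F (r • c) = r * F c)
    (hind : ∀ s : Finset V, F ((s : Set V).indicator 1) = 0) {c : V → ℝ} (hc : 0 ≤ c) :
    F c = 0 := by
  classical
  induction hn : (Finset.univ.filter fun v => c v ≠ 0) using Finset.strongInduction
    generalizing c with
  | H s ih =>
    subst hn
    set s := Finset.univ.filter fun v => c v ≠ 0 with hs
    have hmem (v) : v ∈ s ↔ c v ≠ 0 := by simp [hs]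
    rcases s.eq_empty_or_nonempty with h | h
    · have hc0 : c = 0 := by
        funext v
        by_contra hv
        have := (hmem v).2 hv
        simp [h] at this
      have := hsmul 0 0 le_rfl
      rwa [zero_smul, zero_mul, ← hc0] at this
    · obtain ⟨w, hw, hmin⟩ := s.exists_min_image c h
      have hcw : 0 ≤ c w := hc w
      -- Subtracting the least nonzero value on the support kills the coordinate `w`, so the support
      -- shrinks strictly.
      set d : V → ℝ := c - c w • (s : Set V).indicator 1 with hd
      have hdv (v) : d v = if v ∈ s then c v - c w else 0 := by
        have := hmem v
        simp only [hd, Pi.sub_apply, Pi.smul_apply, Set.indicator_apply, Finset.mem_coe]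
        split_ifs with hv
        · simp
        · simp only [hv, false_iff, not_not] at this
          simp [this]
      have hd0 : 0 ≤ d := by
        intro v
        rw [hdv]
        split_ifs with hv
        · simpa using hmin v hv
        · simp
      have hdF : F d = 0 := by
        refine ih _ ?_ hd0 rfl
        refine Finset.ssubset_iff_subset_ne.2 ⟨fun v hv => ?_, fun hEq => ?_⟩
        · by_contra hvs
          simp [hdv, hvs] at hv
        · rw [← hEq] at hw
          simp only [Finset.mem_filter, hdv] at hw
          simp at hw
      have hcd : c = c w • (s : Set V).indicator 1 + d := by rw [hd]; abel
      rw [hcd, hF, hsmul _ _ hcw, hind, hdF, mul_zero, add_zero]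
      intro x y _
      have hx : 0 ≤ d x := hd0 x
      have hy : 0 ≤ d y := hd0 y
      simp only [Pi.smul_apply, Set.indicator_apply, Finset.mem_coe, Pi.one_apply, smul_eq_mul]
      by_cases hxs : x ∈ s
      · by_cases hys : y ∈ s
        · simpa only [hxs, hys, if_true, le_refl, true_and] using le_total (d x) (d y)
        · have hdy : d y = 0 := by rw [hdv y, if_neg hys]
          exact Or.inr ⟨by simp [hxs, hys, hcw], hdy.trans_le hx⟩
      · have hdx : d x = 0 := by rw [hdv x, if_neg hxs]
        exact Or.inl ⟨by by_cases hys : y ∈ s <;> simp [hxs, hys, hcw], hdx.trans_le hy⟩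

theorem eq_zero [Fintype V] (hF : G.AdditiveOnRegions F)
    (hsmul : ∀ (r : ℝ) c, 0 ≤ r → F (r • c) = r * F c)
    (hclique : ∀ s : Finset V, G.IsClique s → F ((s : Set V).indicator 1) = 0) (c : V → ℝ) :
    F c = 0 := by
  have hpos {c : V → ℝ} (hc : 0 ≤ c) : F c = 0 :=
    hF.eq_zero_of_nonneg hsmul (hF.indicator_eq_zero hclique) hc
  have hr : 0 ≤ ∑ v, |c v| := Finset.sum_nonneg fun v _ => abs_nonneg _
  -- A constant vector lies in every region; this one is large enough to make the sum with `c`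
  -- nonnegative.
  have h := hF c (fun _ => ∑ v, |c v|) fun u v _ => by
    rcases le_total (c u) (c v) with h | h <;> simp [h]
  rw [hpos fun _ => hr, hpos] at h
  · linarith
  · intro v
    have h1 := Finset.single_le_sum (f := fun v => |c v|) (fun v _ => abs_nonneg _)
      (Finset.mem_univ v)
    have h2 := neg_abs_le (c v)
    simp only [Pi.zero_apply, Pi.add_apply]
    linarith

end AdditiveOnRegions

end SimpleGraph

/-! ### Simplicial cones and lineality -/

namespace PointedCone

variable {M : Type*} [AddCommGroup M] [Module ℝ M]

/-- In coordinates the cone is an orthant, and `p` is the coordinatewise minimum of `a` and `b`. -/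
theorem IsSimplicial.riesz_decomposition {K : PointedCone ℝ M} (hK : K.IsSimplicial)
    {a a' b b' : M} (ha : a ∈ K) (ha' : a' ∈ K) (hb : b ∈ K) (hb' : b' ∈ K)
    (h : a + a' = b + b') : ∃ p ∈ K, a - p ∈ K ∧ b - p ∈ K ∧ b' - (a - p) ∈ K := by
  obtain ⟨s, hs, hli, rfl⟩ := hK
  lift s to Finset M using hs
  have hmem {x : M} : x ∈ hull ℝ (s : Set M) ↔ ∃ w : M → ℝ, (∀ y, 0 ≤ w y) ∧
      ∑ y ∈ s, w y • y = x := by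
    constructor
    · intro hx
      obtain ⟨f, -, hf⟩ := Submodule.mem_span_finset.1 hx
      exact ⟨fun y => f y, fun y => (f y).2, hf⟩
    · rintro ⟨w, hw, rfl⟩
      exact Submodule.sum_mem _ fun y hy =>
        Submodule.smul_mem _ (⟨w y, hw y⟩ : {c : ℝ // 0 ≤ c}) (subset_hull hy)
  obtain ⟨f, hf, rfl⟩ := hmem.1 ha
  obtain ⟨f', hf', rfl⟩ := hmem.1 ha'
  obtain ⟨g, hg, rfl⟩ := hmem.1 hb
  obtain ⟨g', hg', rfl⟩ := hmem.1 hb'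
  have hcoord : ∀ y ∈ s, f y + f' y = g y + g' y := by
    intro y hy
    have h0 := linearIndepOn_finset_iff.1 hli (fun y => f y + f' y - (g y + g' y)) (by
      simp only [sub_smul, add_smul, Finset.sum_sub_distrib, Finset.sum_add_distrib, id]
      rw [h, sub_self]) y hy
    linarith
  refine ⟨∑ y ∈ s, min (f y) (g y) • y, hmem.2 ⟨_, fun y => le_min (hf y) (hg y), rfl⟩,
    hmem.2 ⟨fun y => f y - min (f y) (g y), fun y => sub_nonneg.2 (min_le_left _ _), ?_⟩,
    hmem.2 ⟨fun y => g y - min (f y) (g y), fun y => sub_nonneg.2 (min_le_right _ _), ?_⟩,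
    -- The coordinate identity is known only on `s`; the `max 0` keeps the weight nonnegative
    -- elsewhere.
    hmem.2 ⟨fun y => max 0 (g' y - (f y - min (f y) (g y))), fun y => le_max_left _ _, ?_⟩⟩
  · simp only [sub_smul, Finset.sum_sub_distrib]
  · simp only [sub_smul, Finset.sum_sub_distrib]
  · simp only [← Finset.sum_sub_distrib, ← sub_smul]
    refine Finset.sum_congr rfl fun y hy => ?_
    rw [max_eq_right]
    have := hcoord y hy
    rcases min_cases (f y) (g y) with ⟨h1, h2⟩ | ⟨h1, h2⟩ <;> rw [h1] <;>
      linarith [hf y, hf' y, hg y, hg' y]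

/-- A linear functional that is nonnegative on a cone vanishes on its lineality space. -/
theorem lineal_le_ker {C : PointedCone ℝ M} {f : M →ₗ[ℝ] ℝ} (hf : ∀ x ∈ C, 0 ≤ f x) :
    C.lineal ≤ LinearMap.ker f := by
  intro x hx
  have h1 := hf x hx.1
  have h2 := hf (-x) hx.2
  rw [map_neg] at h2
  rw [LinearMap.mem_ker]
  linarith

end PointedCone

/-! ### Edge segments and the triangle-free case -/

section GraphicalZonotope

open VirtualPolytope

variable {V : Type*} [Fintype V] [DecidableEq V]

/-- The segment `[e_u, e_v]` associated to an unordered pair `s(u, v)`. -/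
noncomputable def edgeSegment (e : Sym2 V) : Polytope (V → ℝ) :=
  Sym2.lift ⟨fun u v => segmentPolytope (Pi.single u (1 : ℝ)) (Pi.single v (1 : ℝ)),
    fun _ _ => segmentPolytope_comm _ _⟩ e

theorem support_edgeSegment (u v : V) (c : V → ℝ) :
    (edgeSegment s(u, v)).support c = max (c u) (c v) :=
  (Polytope.support_segmentPolytope _ _ c).trans (by simp)

/-- The defect of additivity of the support function at the pair `(e_u, e_v)`. -/
noncomputable def edgeDefect (e : Sym2 V) : VirtualPolytope (V → ℝ) →ₗ[ℝ] ℝ :=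
  Sym2.lift ⟨fun u v => defect (Pi.single u 1) (Pi.single v 1), fun _ _ =>
    defect_comm _ _⟩ e

theorem edgeDefect_of (u v : V) (P : Polytope (V → ℝ)) :
    edgeDefect s(u, v) (of P) = P.support (Pi.single u 1) + P.support (Pi.single v 1) -
      P.support (Pi.single u 1 + Pi.single v 1) :=
  defect_of _ _ P

theorem edgeDefect_of_nonneg (e : Sym2 V) (P : Polytope (V → ℝ)) : 0 ≤ edgeDefect e (of P) := by
  induction e with
  | _ u v => exact defect_of_nonneg _ _ P

/-- Duality of defects and segments: it gives both the coefficients of a summand and linear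
independence. -/
theorem edgeDefect_edgeSegment {e e' : Sym2 V} (he : ¬ e.IsDiag) (he' : ¬ e'.IsDiag) :
    edgeDefect e (of (edgeSegment e')) = if e = e' then 1 else 0 := by
  induction e with
  | _ u v =>
    induction e' with
    | _ x y =>
      rw [Sym2.mk_isDiag_iff] at he he'
      simp only [edgeDefect_of, support_edgeSegment, Pi.add_apply, Pi.single_apply, Sym2.eq_iff]
      by_cases x = u <;> by_cases x = v <;> by_cases y = u <;> by_cases y = v <;>
        simp_all [eq_comm]

variable (G : SimpleGraph V) [DecidableRel G.Adj]

theorem graphicalZonotope_eq_sum : graphicalZonotope G = ∑ e ∈ G.edgeFinset, edgeSegment e := rfl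

variable {G}

theorem additiveOnRegions_edgeSegment {e : Sym2 V} (he : e ∈ G.edgeFinset) :
    G.AdditiveOnRegions (edgeSegment e).support := by
  induction e with
  | _ u v =>
    intro c d h
    rw [SimpleGraph.mem_edgeFinset, SimpleGraph.mem_edgeSet] at he
    simp only [support_edgeSegment, Pi.add_apply]
    rcases h u v he with ⟨h1, h2⟩ | ⟨h1, h2⟩
    · rw [max_eq_right h1, max_eq_right h2, max_eq_right (add_le_add h1 h2)]
    · rw [max_eq_left h1, max_eq_left h2, max_eq_left (add_le_add h1 h2)]

variable (G) in
theorem additiveOnRegions_graphicalZonotope :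
    G.AdditiveOnRegions (graphicalZonotope G).support := by
  have h : (graphicalZonotope G).support = ∑ e ∈ G.edgeFinset, (edgeSegment e).support := by
    funext c
    rw [graphicalZonotope_eq_sum, Polytope.support_sum, Finset.sum_apply]
  rw [h]
  exact SimpleGraph.AdditiveOnRegions.sum fun e he => additiveOnRegions_edgeSegment he

theorem IsWeakMinkowskiSummand.additiveOnRegions {Q : Polytope (V → ℝ)}
    (h : IsWeakMinkowskiSummand Q (graphicalZonotope G)) : G.AdditiveOnRegions Q.support :=
  fun c d hcd => h.support_add (additiveOnRegions_graphicalZonotope G c d hcd)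

theorem of_edgeSegment_mem {e : Sym2 V} (he : e ∈ G.edgeFinset) :
    of (edgeSegment e) ∈ deformationCone (graphicalZonotope G) :=
  ⟨_, ⟨1, ∑ e ∈ G.edgeFinset.erase e, edgeSegment e, by
    rw [Finset.add_sum_erase _ _ he, one_smul, graphicalZonotope_eq_sum]⟩, rfl⟩

/-- A weak Minkowski summand of the graphical zonotope of a triangle-free graph is a translate of a
nonnegative combination of the edge segments. -/
theorem IsWeakMinkowskiSummand.eq_sum_edgeSegment (hG : G.CliqueFree 3) {Q : Polytope (V → ℝ)}
    (h : IsWeakMinkowskiSummand Q (graphicalZonotope G)) :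
    ∃ (y : Sym2 V → ℝ≥0) (t : V → ℝ),
      Q = ∑ e ∈ G.edgeFinset, y e • edgeSegment e + segmentPolytope t t := by
  let y (e : Sym2 V) : ℝ≥0 := ⟨edgeDefect e (of Q), edgeDefect_of_nonneg e Q⟩
  let P : Polytope (V → ℝ) := ∑ e ∈ G.edgeFinset, y e • edgeSegment e
  have hP (c) : P.support c = ∑ e ∈ G.edgeFinset, y e * (edgeSegment e).support c := by
    simp only [P, Polytope.support_sum, Polytope.support_smul]
  have hPadd : G.AdditiveOnRegions P.support := by
    have : P.support = ∑ e ∈ G.edgeFinset, (y e : ℝ) • (edgeSegment e).support := by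
      funext c
      simp [hP]
    rw [this]
    exact SimpleGraph.AdditiveOnRegions.sum fun e he => (additiveOnRegions_edgeSegment he).smul _
  -- The translation is chosen to match `Q` on the standard basis vectors.
  let t (v : V) : ℝ := Q.support (Pi.single v 1) - P.support (Pi.single v 1)
  let f : (V → ℝ) →ₗ[ℝ] ℝ := dotProductBilin ℝ ℝ t
  have hf (c) : f c = c ⬝ᵥ t := dotProduct_comm t c
  have hPdef {u v : V} (huv : G.Adj u v) :
      edgeDefect s(u, v) (of P) = edgeDefect s(u, v) (of Q) := by
    simp only [P, map_sum, ← coe_smul_of, map_smul]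
    rw [Finset.sum_eq_single s(u, v)]
    · rw [edgeDefect_edgeSegment (by simpa using huv.ne) (by simpa using huv.ne), if_pos rfl,
        smul_eq_mul, mul_one]
      rfl
    · intro e he hne
      rw [edgeDefect_edgeSegment (by simpa using huv.ne)
        (G.not_isDiag_of_mem_edgeFinset he), if_neg hne.symm, smul_zero]
    · intro hne
      exact absurd (SimpleGraph.mem_edgeFinset.2 huv) hne
  refine ⟨y, t, Polytope.ext_support fun c => ?_⟩
  have key := ((h.additiveOnRegions.sub hPadd).sub (.linearMap f)).eq_zero ?_ ?_ c
  · simp only [Pi.sub_apply, hf] at key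
    rw [Polytope.support_add, Polytope.support_segmentPolytope, max_self]
    linarith
  · intro r c hr
    simp only [Pi.sub_apply, Polytope.support_smul_right _ hr, map_smul, smul_eq_mul]
    ring
  · intro s hs
    have hsingle (v) : f (Pi.single v 1) = Q.support (Pi.single v 1) - P.support (Pi.single v 1) := by
      rw [hf, single_one_dotProduct]
    -- Triangle-freeness enters here. The empty clique is handled by homogeneity, vertices by `t`,
    -- and edges by `y`.
    have hcard : s.card < 3 := by
      by_contra! hcon
      exact (hG.mono hcon) s ⟨hs, rfl⟩
    interval_cases hn : s.card
    · rw [Finset.card_eq_zero] at hn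
      subst hn
      have h0 (R : Polytope (V → ℝ)) : R.support 0 = 0 := by
        simpa using R.support_smul_right le_rfl (0 : V → ℝ)
      have : ((∅ : Finset V) : Set V).indicator (1 : V → ℝ) = 0 := by
        rw [Finset.coe_empty, Set.indicator_empty']
      rw [this]
      simp [h0]
    · obtain ⟨v, rfl⟩ := Finset.card_eq_one.1 hn
      have : (({v} : Finset V) : Set V).indicator (1 : V → ℝ) = Pi.single v 1 := by
        funext w
        simp [Set.indicator_apply, Pi.single_apply]
      rw [this]
      simp [hsingle]
    · obtain ⟨u, v, huv, rfl⟩ := Finset.card_eq_two.1 hn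
      have : (({u, v} : Finset V) : Set V).indicator (1 : V → ℝ) =
          Pi.single u 1 + Pi.single v 1 := by
        funext w
        by_cases w = u <;> by_cases w = v <;> simp_all
      have hd := hPdef (hs (by simp) (by simp) huv)
      rw [edgeDefect_of, edgeDefect_of] at hd
      rw [this]
      simp only [Pi.sub_apply, map_add, hsingle]
      linarith

theorem isSimplicialModLineality_of_cliqueFree (hG : G.CliqueFree 3) :
    (deformationCone (graphicalZonotope G)).IsSimplicialModLineality := by
  set C := deformationCone (graphicalZonotope G) with hC
  let g (e : Sym2 V) := C.lineal.mkQ (of (edgeSegment e))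
  refine ⟨g '' G.edgeFinset, G.edgeFinset.finite_toSet.image g, LinearIndepOn.id_image ?_, ?_⟩
  · have hker (e : Sym2 V) : C.lineal ≤ LinearMap.ker (edgeDefect e) := by
      refine PointedCone.lineal_le_ker ?_
      rintro _ ⟨Q, -, rfl⟩
      exact edgeDefect_of_nonneg e Q
    rw [linearIndepOn_finset_iff]
    intro w hw e he
    have h := congr_arg (C.lineal.liftQ (edgeDefect e) (hker e)) hw
    simp only [g, map_sum, map_smul, map_zero, Submodule.mkQ_apply, Submodule.liftQ_apply] at h
    rw [Finset.sum_eq_single e] at h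
    · simpa [edgeDefect_edgeSegment (G.not_isDiag_of_mem_edgeFinset he)
        (G.not_isDiag_of_mem_edgeFinset he)] using h
    · intro e' he' hne
      rw [edgeDefect_edgeSegment (G.not_isDiag_of_mem_edgeFinset he)
        (G.not_isDiag_of_mem_edgeFinset he'), if_neg hne.symm, smul_zero]
    · exact fun hne => absurd he hne
  · refine le_antisymm (Submodule.span_le.2 ?_) ?_
    · rintro _ ⟨e, he, rfl⟩
      exact ⟨_, of_edgeSegment_mem he, rfl⟩
    · rintro _ ⟨_, ⟨Q, hQ, rfl⟩, rfl⟩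
      obtain ⟨y, t, rfl⟩ := hQ.eq_sum_edgeSegment hG
      have hsum : C.lineal.mkQ (of (∑ e ∈ G.edgeFinset, y e • edgeSegment e +
          segmentPolytope t t)) = ∑ e ∈ G.edgeFinset, (y e : ℝ) • g e := by
        rw [map_add, map_add, Submodule.mkQ_apply _ (of (segmentPolytope t t)),
          (Submodule.Quotient.mk_eq_zero _).2 (of_point_mem_lineal t _), add_zero, map_sum, map_sum]
        refine Finset.sum_congr rfl fun e _ => ?_
        rw [← coe_smul_of, map_smul]
      refine (Submodule.mem_carrier _).1 ?_
      change C.lineal.mkQ _ ∈ PointedCone.hull ℝ _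
      rw [hsum]
      exact Submodule.sum_mem _ fun e he => Submodule.smul_mem _ (y e)
        (PointedCone.subset_hull ⟨e, he, rfl⟩)

end GraphicalZonotope

/-! ### The obstruction from a triangle -/

section Triangle

open VirtualPolytope

variable {V : Type*} [Fintype V] [DecidableEq V] {G : SimpleGraph V} [DecidableRel G.Adj]

/-- The triangle with vertices `e_i`, `e_j` and `e_k`. -/
def trianglePolytope (i j k : V) : Polytope (V → ℝ) :=
  Polytope.ofFinite {Pi.single i 1, Pi.single j 1, Pi.single k 1} (Set.toFinite _)
    (Set.insert_nonempty _ _)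

/-- The inverted triangle with vertices `e_i + e_j`, `e_i + e_k` and `e_j + e_k`. -/
def invertedTriangle (i j k : V) : Polytope (V → ℝ) :=
  Polytope.ofFinite {Pi.single i 1 + Pi.single j 1, Pi.single i 1 + Pi.single k 1,
    Pi.single j 1 + Pi.single k 1} (Set.toFinite _) (Set.insert_nonempty _ _)

theorem support_trianglePolytope (i j k : V) (c : V → ℝ) :
    (trianglePolytope i j k).support c = max (c i) (max (c j) (c k)) :=
  (Polytope.support_ofFinite_triple _ _ _ c).trans (by simp)

theorem support_invertedTriangle (i j k : V) (c : V → ℝ) :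
    (invertedTriangle i j k).support c = max (c i + c j) (max (c i + c k) (c j + c k)) :=
  (Polytope.support_ofFinite_triple _ _ _ c).trans (by simp [dotProduct_add])

/-- If the three coordinates of `c` are sorted as `x ≥ y ≥ z`, both support functions equal `2x +
y`. -/
theorem trianglePolytope_add_invertedTriangle (i j k : V) :
    trianglePolytope i j k + invertedTriangle i j k =
      edgeSegment s(i, j) + (edgeSegment s(i, k) + edgeSegment s(j, k)) := by
  refine Polytope.ext_support fun c => ?_
  simp only [Polytope.support_add, support_edgeSegment, support_trianglePolytope,
    support_invertedTriangle]
  grind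

/-- The third difference of the support function on the Boolean cube spanned by `e_i`, `e_j` and
`e_k`. -/
noncomputable def thirdDifference (i j k : V) : VirtualPolytope (V → ℝ) →ₗ[ℝ] ℝ :=
  let h (c : V → ℝ) : ((V → ℝ) → ℝ) →ₗ[ℝ] ℝ := LinearMap.proj (R := ℝ) (φ := fun _ => ℝ) c
  (h (Pi.single i 1) + h (Pi.single j 1) + h (Pi.single k 1)
    - h (Pi.single i 1 + Pi.single j 1) - h (Pi.single i 1 + Pi.single k 1)
    - h (Pi.single j 1 + Pi.single k 1)
    + h (Pi.single i 1 + Pi.single j 1 + Pi.single k 1)) ∘ₗ support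

theorem thirdDifference_of (i j k : V) (P : Polytope (V → ℝ)) :
    thirdDifference i j k (of P) = P.support (Pi.single i 1) + P.support (Pi.single j 1) +
      P.support (Pi.single k 1) - P.support (Pi.single i 1 + Pi.single j 1) -
      P.support (Pi.single i 1 + Pi.single k 1) - P.support (Pi.single j 1 + Pi.single k 1) +
      P.support (Pi.single i 1 + Pi.single j 1 + Pi.single k 1) := by
  simp [thirdDifference, support_of]

theorem thirdDifference_swap (i j k : V) : thirdDifference i j k = thirdDifference i k j := by
  simp only [thirdDifference, add_right_comm _ (Pi.single k 1 : V → ℝ) (Pi.single j 1),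
    add_comm (Pi.single k 1 : V → ℝ) (Pi.single j 1)]
  congr 1
  abel

theorem thirdDifference_trianglePolytope {i j k : V} (hij : i ≠ j) (hik : i ≠ k) (hjk : j ≠ k) :
    thirdDifference i j k (of (trianglePolytope i j k)) = 1 := by
  simp only [thirdDifference_of, support_trianglePolytope, Pi.add_apply, Pi.single_apply]
  simp [hij, hik, hjk, hij.symm, hik.symm, hjk.symm]

/-- With `h` the support function, the difference of the two sides is `h(e_i + e_k) + h(e_j + e_k) -
h(e_i + e_j + e_k) - h(e_k)`. The last two arguments lie in a common region, so this is an instance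
of subadditivity. -/
theorem thirdDifference_le_edgeDefect {x : VirtualPolytope (V → ℝ)}
    (hx : x ∈ deformationCone (graphicalZonotope G)) {i j k : V} (hij : i ≠ j) (hik : i ≠ k)
    (hjk : j ≠ k) : thirdDifference i j k x ≤ edgeDefect s(i, j) x := by
  obtain ⟨Q, hQ, rfl⟩ := hx
  have h1 := hQ.additiveOnRegions (Pi.single i 1 + Pi.single j 1 + Pi.single k 1) (Pi.single k 1) (by
    intro u v _
    simp only [Pi.add_apply, Pi.single_apply]
    by_cases u = i <;> by_cases u = j <;> by_cases u = k <;> by_cases v = i <;>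
      by_cases v = j <;> by_cases v = k <;> simp_all)
  have h2 := Q.support_add_le (Pi.single i 1 + Pi.single k 1) (Pi.single j 1 + Pi.single k 1)
  have h3 : (Pi.single i 1 + Pi.single k 1 + (Pi.single j 1 + Pi.single k 1) : V → ℝ) =
    Pi.single i 1 + Pi.single j 1 + Pi.single k 1 + Pi.single k 1 := by abel
  rw [h3, h1] at h2
  rw [thirdDifference_of, edgeDefect_of]
  linarith

theorem cliqueFree_of_isSimplicialModLineality
    (h : (deformationCone (graphicalZonotope G)).IsSimplicialModLineality) : G.CliqueFree 3 := by
  intro s hs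
  obtain ⟨i, j, k, hij, hik, hjk, -⟩ := SimpleGraph.is3Clique_iff.1 hs
  set C := deformationCone (graphicalZonotope G) with hC
  let π := C.lineal.mkQ
  have hDC (e) (x) (hx : x ∈ C) : 0 ≤ edgeDefect e x := by
    obtain ⟨Q, -, rfl⟩ := hx
    exact edgeDefect_of_nonneg e Q
  have hTC (j k) (hij : i ≠ j) (hik : i ≠ k) (hjk : j ≠ k) (x) (hx : x ∈ C) :
      thirdDifference i j k x ≤ edgeDefect s(i, j) x :=
    thirdDifference_le_edgeDefect hx hij hik hjk
  have hD (e) := PointedCone.lineal_le_ker (hDC e)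
  -- The defect and its difference with the third difference are both nonnegative on the cone, so
  -- both vanish on the lineality space.
  have hT : C.lineal ≤ LinearMap.ker (thirdDifference i j k) := by
    intro x hx
    have h1 := PointedCone.lineal_le_ker (f := edgeDefect s(i, j) - thirdDifference i j k)
      (fun x hx => sub_nonneg.2 (hTC j k hij.ne hik.ne hjk.ne x hx)) hx
    have h2 := hD s(i, j) hx
    rw [LinearMap.mem_ker] at *
    rw [LinearMap.sub_apply] at h1
    linarith
  let D (e) := C.lineal.liftQ (edgeDefect e) (hD e)
  let T := C.lineal.liftQ (thirdDifference i j k) hT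
  have hDK (e) {x} (hx : x ∈ C.map π) : 0 ≤ D e x := by
    obtain ⟨x, hx, rfl⟩ := hx
    exact hDC e x hx
  have hTij {x} (hx : x ∈ C.map π) : T x ≤ D s(i, j) x := by
    obtain ⟨x, hx, rfl⟩ := hx
    exact hTC j k hij.ne hik.ne hjk.ne x hx
  have hTik {x} (hx : x ∈ C.map π) : T x ≤ D s(i, k) x := by
    obtain ⟨x, hx, rfl⟩ := hx
    change thirdDifference i j k x ≤ _
    rw [thirdDifference_swap]
    exact hTC k j hik.ne hij.ne hjk.ne' x hx
  have hseg {e} (he : e ∈ G.edgeFinset) : π (of (edgeSegment e)) ∈ C.map π :=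
    ⟨_, of_edgeSegment_mem he, rfl⟩
  have hle {e e'} (he : e ∈ G.edgeFinset) (he' : e' ∈ G.edgeFinset) (hne : e ≠ e') {x}
      (hx : π (of (edgeSegment e')) - x ∈ C.map π) : D e x ≤ 0 := by
    have h1 := hDK e hx
    have h2 : D e (π (of (edgeSegment e'))) = 0 :=
      (edgeDefect_edgeSegment (G.not_isDiag_of_mem_edgeFinset he)
        (G.not_isDiag_of_mem_edgeFinset he')).trans (if_neg hne)
    rw [map_sub, h2] at h1
    linarith
  have eij : s(i, j) ∈ G.edgeFinset := SimpleGraph.mem_edgeFinset.2 hij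
  have eik : s(i, k) ∈ G.edgeFinset := SimpleGraph.mem_edgeFinset.2 hik
  have ejk : s(j, k) ∈ G.edgeFinset := SimpleGraph.mem_edgeFinset.2 hjk
  have nij : s(i, j) ≠ s(i, k) := by simp [hjk.ne, hij.ne']
  have nij' : s(i, j) ≠ s(j, k) := by simp [hij.ne, hik.ne]
  have nik : s(i, k) ≠ s(j, k) := by simp [hij.ne, hik.ne]
  have hZ : trianglePolytope i j k + (invertedTriangle i j k +
      ∑ e ∈ G.edgeFinset \ {s(i, j), s(i, k), s(j, k)}, edgeSegment e) = graphicalZonotope G := by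
    rw [← add_assoc, trianglePolytope_add_invertedTriangle, graphicalZonotope_eq_sum,
      ← Finset.sum_sdiff (s₁ := {s(i, j), s(i, k), s(j, k)}) (s₂ := G.edgeFinset),
      Finset.sum_insert (by simp only [Finset.mem_insert, Finset.mem_singleton, nij, nij',
        or_self, not_false_iff]),
      Finset.sum_pair nik, add_comm]
    intro e he
    simp only [Finset.mem_insert, Finset.mem_singleton] at he
    rcases he with rfl | rfl | rfl <;> assumption
  have ha : π (of (trianglePolytope i j k)) ∈ C.map π :=
    ⟨_, ⟨_, ⟨1, _, hZ.trans (one_smul _ _).symm⟩, rfl⟩, rfl⟩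
  have ha' : π (of (invertedTriangle i j k)) ∈ C.map π :=
    ⟨_, ⟨_, ⟨1, _, (add_left_comm _ _ _).trans (hZ.trans (one_smul _ _).symm)⟩, rfl⟩, rfl⟩
  -- Two Riesz decompositions split the triangle into `p`, `q` and a remainder, lying below the
  -- segments of `ij`, `ik` and `jk` in the order of the cone.
  obtain ⟨p, hp, hap, hbp, hcp⟩ := h.riesz_decomposition ha ha' (hseg eij)
    (Submodule.add_mem _ (hseg eik) (hseg ejk)) (by
      simp only [← map_add, trianglePolytope_add_invertedTriangle])
  obtain ⟨q, hq, haq, hbq, hcq⟩ := h.riesz_decomposition hap hcp (hseg eik) (hseg ejk) (by abel)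
  have hTa : T (π (of (trianglePolytope i j k))) = 1 :=
    thirdDifference_trianglePolytope hij.ne hik.ne hjk.ne
  -- Each piece is tested against the defect at an edge other than the one it lies below.
  have h1 := (hTik hp).trans (hle eik eij nij.symm hbp)
  have h2 := (hTij hq).trans (hle eij eik nij hbq)
  have h3 := (hTij haq).trans (hle eij ejk nij' hcq)
  rw [map_sub, map_sub] at h3
  linarith

end Triangle

theorem mainTheorem4 {V : Type*} [Fintype V] [DecidableEq V] (G : SimpleGraph V)
    [DecidableRel G.Adj] :
    (deformationCone (graphicalZonotope G)).IsSimplicialModLineality ↔ G.CliqueFree 3 :=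
  ⟨cliqueFree_of_isSimplicialModLineality, isSimplicialModLineality_of_cliqueFree⟩
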